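/- Let $K$ be a field and $R=K[x_1,\dots,x_n]$ with the standard grading. For an ideal $I\subseteq R$ let $\mathrm{ass}(I)$ denote the set of associated primes of $R/I$. A monomial ideal $I\subseteq R$ is called ass-decomposable (a recursive definition) if either $I$ is primary, or there are a variable $x_i\notin\sqrt I$ and an integer $k\ge 1$ such that $\mathrm{ass}\big((I,x_i^k)\big)=\{\mathfrak p\in\mathrm{ass}(I) : x_i\in\mathfrak p\}$ and both $(I,x_i^k)$ and $I:x_i^k$ are ass-decomposable. For a finitely generated graded $R$-module $M$ with minimal graded free resolution $\cdots\to F_1\to F_0\to M\to 0$, $F_i=\bigoplus_j R(-j)^{\beta_{i,j}}$, the Castelnuovo–Mumford regularity is $\mathrm{reg}(M)=\sup\{j-i : \beta_{i,j}\neq 0\}$. Proposition. Let $I\subseteq R$ be a squarefree monomial ideal with minimal (irredundant) prime decomposition $I=\mathfrak p_1\cap\dots\cap\mathfrak p_r$, so that $r$ is the number of minimal primes of $I$ (the index of irreducibility of $I$). If $I$ is ass-decomposable, then $\mathrm{reg}(R/I)\le r-1$. -/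

import Mathlib

open MvPolynomial

/-- `I` is a monomial ideal of `K[x_1, …, x_n]`: it is generated by a set of monomials. -/
def IsMonomialIdeal {n : ℕ} {K : Type*} [Field K] (I : Ideal (MvPolynomial (Fin n) K)) : Prop :=
  ∃ S : Set (Fin n →₀ ℕ), I = Ideal.span ((fun s => monomial s (1 : K)) '' S)

/-- `I` is a squarefree monomial ideal: it is generated by a set of squarefree monomials. -/
def IsSquarefreeMonomialIdeal {n : ℕ} {K : Type*} [Field K]
    (I : Ideal (MvPolynomial (Fin n) K)) : Prop :=
  ∃ S : Set (Fin n →₀ ℕ), (∀ s ∈ S, ∀ i, s i ≤ 1) ∧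
    I = Ideal.span ((fun s => monomial s (1 : K)) '' S)

/-- The set `ass(I)` of associated prime ideals of `R / I`. -/
def idealAss {R : Type*} [CommRing R] (I : Ideal R) : Set (Ideal R) :=
  associatedPrimes R (R ⧸ I)

/-- Ass-decomposable monomial ideals: a monomial ideal `I` is ass-decomposable if it is primary, or
if there are a variable `x_i ∉ √I` and `k ≥ 1` such that
`ass(I, x_i^k) = {𝔭 ∈ ass(I) | x_i ∈ 𝔭}` and both `(I, x_i^k)` and `I : x_i^k` are
ass-decomposable. -/
inductive AssDecomposable {n : ℕ} {K : Type*} [Field K] :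
    Ideal (MvPolynomial (Fin n) K) → Prop
  | primary (I : Ideal (MvPolynomial (Fin n) K)) (hmon : IsMonomialIdeal I)
      (hI : I.IsPrimary) : AssDecomposable I
  | step (I : Ideal (MvPolynomial (Fin n) K)) (hmon : IsMonomialIdeal I)
      (i : Fin n) (k : ℕ) (hk : 0 < k) (hx : (X i : MvPolynomial (Fin n) K) ∉ I.radical)
      (hass : idealAss (I ⊔ Ideal.span {(X i : MvPolynomial (Fin n) K) ^ k}) =
        {p ∈ idealAss I | (X i : MvPolynomial (Fin n) K) ∈ p})
      (hadd : AssDecomposable (I ⊔ Ideal.span {(X i : MvPolynomial (Fin n) K) ^ k}))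
      (hcolon : AssDecomposable (I.colon {(X i : MvPolynomial (Fin n) K) ^ k})) :
      AssDecomposable I

/-- `I = 𝔭_1 ∩ … ∩ 𝔭_r` is a minimal (irredundant) prime decomposition of `I`. -/
structure IsMinimalPrimeDecomposition {R : Type*} [CommRing R] {r : ℕ} (I : Ideal R)
    (p : Fin r → Ideal R) : Prop where
  isPrime : ∀ i, (p i).IsPrime
  iInf_eq : I = ⨅ i, p i
  irredundant : ∀ i, ¬ (⨅ j, ⨅ _ : j ≠ i, p j) ≤ p i

/-- The homogeneous component of degree `d ∈ ℤ` of `K[x_1, …, x_n]` in the standard grading; it is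
zero for `d < 0`. -/
noncomputable def polyComponent (n : ℕ) (K : Type*) [Field K] (d : ℤ) :
    Submodule K (MvPolynomial (Fin n) K) :=
  if 0 ≤ d then homogeneousSubmodule (Fin n) K d.toNat else ⊥

/-- The component of degree `d ∈ ℤ` of `R / I`, where `R = K[x_1, …, x_n]`: the image of the
component of degree `d` of `R`. For homogeneous `I` this is the standard grading of `R / I`. -/
noncomputable def quotientComponent {n : ℕ} {K : Type*} [Field K]
    (I : Ideal (MvPolynomial (Fin n) K)) (d : ℤ) : Submodule K (MvPolynomial (Fin n) K ⧸ I) :=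
  (polyComponent n K d).map (Ideal.Quotient.mkₐ K I).toLinearMap

/-- A graded free resolution `⋯ → F_2 → F_1 → F_0 → M → 0` by graded free `R`-modules of finite
rank, `R = K[x_1, …, x_n]`, of an `R`-module `M` with the grading `ℳ`.
Here `F_i = ⊕_a R(-deg i a)` with `a` running over a basis of `rank i` elements, the basis element
`a` having degree `deg i a`; all maps are homogeneous of degree zero. -/
structure GradedFreeResolution (n : ℕ) {K : Type*} [Field K] {M : Type*} [AddCommGroup M]
    [Module (MvPolynomial (Fin n) K) M] [Module K M] (ℳ : ℤ → Submodule K M) where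
  /-- the rank of `F_i` -/
  rank : ℕ → ℕ
  /-- the degrees of the basis elements of `F_i` -/
  deg : ∀ i, Fin (rank i) → ℤ
  /-- the differential `F_{i+1} → F_i` -/
  diff : ∀ i, (Fin (rank (i + 1)) → MvPolynomial (Fin n) K) →ₗ[MvPolynomial (Fin n) K]
    (Fin (rank i) → MvPolynomial (Fin n) K)
  /-- the augmentation `F_0 → M` -/
  aug : (Fin (rank 0) → MvPolynomial (Fin n) K) →ₗ[MvPolynomial (Fin n) K] M
  diff_mem : ∀ i b a, diff i (Pi.single b 1) a ∈ polyComponent n K (deg (i + 1) b - deg i a)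
  aug_mem : ∀ a, aug (Pi.single a 1) ∈ ℳ (deg 0 a)
  exact_succ : ∀ i, Function.Exact (diff (i + 1)) (diff i)
  exact_zero : Function.Exact (diff 0) aug
  aug_surjective : Function.Surjective aug

namespace GradedFreeResolution

variable {n : ℕ} {K : Type*} [Field K] {M : Type*} [AddCommGroup M]
  [Module (MvPolynomial (Fin n) K) M] [Module K M] {ℳ : ℤ → Submodule K M}

/-- The resolution is minimal: the image of `F_{i+1} → F_i` lies in `𝔪 F_i` for all `i`, where
`𝔪 = (x_1, …, x_n)`. -/
def IsMinimal (F : GradedFreeResolution n ℳ) : Prop :=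
  ∀ i v a, F.diff i v a ∈ idealOfVars (Fin n) K

/-- The multiplicity `β_{i,j}` of the summand `R(-j)` in `F_i`. -/
def betti (F : GradedFreeResolution n ℳ) (i : ℕ) (j : ℤ) : ℕ :=
  (Finset.univ.filter fun a => F.deg i a = j).card

end GradedFreeResolution

/-- The Castelnuovo-Mumford regularity `sup {j - i | β_{i,j} ≠ 0}` of a finitely generated graded
module, the `β_{i,j}` being read off from the minimal graded free resolution (which exists, and is
unique up to isomorphism, so that only one value occurs for each `β_{i,j}`). It is `-∞` for the
zero module. -/
noncomputable def castelnuovoMumfordRegularity (n : ℕ) {K : Type*} [Field K] {M : Type*}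
    [AddCommGroup M] [Module (MvPolynomial (Fin n) K) M] [Module K M]
    (ℳ : ℤ → Submodule K M) : EReal :=
  sSup {x | ∃ F : GradedFreeResolution n ℳ, F.IsMinimal ∧
    ∃ (i : ℕ) (j : ℤ), F.betti i j ≠ 0 ∧ x = (((j - i : ℤ) : ℝ) : EReal)}

-- A squarefree monomial ideal with `r` minimal primes is an intersection `I` of at most `r` primes
-- generated by sets of variables (`eq_varIdeal`). For a variable `x` there is the exact sequence `0
-- → (R / (I : x))(-1) → R / I → R / (I, x) → 0`. The primes containing `x` drop out of `I : x`, and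
-- `(I, x)` is the intersection of the primes enlarged by `x`. If some prime contains `x`, then `I :
-- x` involves fewer primes, which pays for the twist, while `(I, x)` involves no more than before.
-- Induction on the variables in which the primes differ leaves at most one prime, whose quotient
-- has regularity at most `0` (`regularTo_varIdeal`).
--
-- Regularity is handled without Tor. `RegularTo` bounds the generator degrees of the start of some
-- resolution, not necessarily minimal. The horseshoe lemma carries such bounds to extensions
-- (`SES.regularTo_middle`) and, by way of relation modules, to cokernels (`SES.regularTo_right`). A
-- Schanuel-type comparison transfers the bound to every minimal resolution (`RegularTo.deg_le`),
-- which suffices because the regularity is a supremum over these (`regularity_le`).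

universe u

/-! ### Homogeneous components of the polynomial ring -/

section PolyComponent

variable {n : ℕ} {K : Type u} [Field K]

theorem mul_mem_polyComponent {a b : ℤ} {p q : MvPolynomial (Fin n) K}
    (hp : p ∈ polyComponent n K a) (hq : q ∈ polyComponent n K b) :
    p * q ∈ polyComponent n K (a + b) := by
  unfold polyComponent at *
  split_ifs at hp with ha
  · split_ifs at hq with hb
    · rw [if_pos (by omega), Int.toNat_add ha hb]
      exact IsHomogeneous.mul hp hq
    · rw [(Submodule.mem_bot K).1 hq, mul_zero]
      exact zero_mem _
  · rw [(Submodule.mem_bot K).1 hp, zero_mul]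
    exact zero_mem _

theorem one_mem_polyComponent : (1 : MvPolynomial (Fin n) K) ∈ polyComponent n K 0 := by
  rw [polyComponent, if_pos le_rfl]
  exact isHomogeneous_one (Fin n) K

theorem X_mem_polyComponent (i : Fin n) :
    (X i : MvPolynomial (Fin n) K) ∈ polyComponent n K 1 := by
  rw [polyComponent, if_pos zero_le_one]
  exact isHomogeneous_X K i

theorem polyComponent_le_idealOfVars {d : ℤ} (hd : 0 < d) {p : MvPolynomial (Fin n) K}
    (hp : p ∈ polyComponent n K d) : p ∈ idealOfVars (Fin n) K := by
  rw [polyComponent, if_pos hd.le] at hp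
  have hp' : p.IsHomogeneous d.toNat := hp
  rw [idealOfVars, ← Set.image_univ, mem_ideal_span_X_image]
  intro m hm
  by_contra! h
  have hm0 : m = 0 := by ext i; simpa using h i
  have := hp' (mem_support_iff.1 hm)
  subst hm0
  simp at this
  omega

/-- The projection of a polynomial to its component of degree `d ∈ ℤ`. -/
noncomputable def polyProj (d : ℤ) : MvPolynomial (Fin n) K →ₗ[K] MvPolynomial (Fin n) K :=
  if 0 ≤ d then homogeneousComponent d.toNat else 0

theorem polyProj_mem (d : ℤ) (p : MvPolynomial (Fin n) K) :
    polyProj d p ∈ polyComponent n K d := by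
  unfold polyProj polyComponent
  split_ifs
  · exact homogeneousComponent_mem _ _
  · simp

theorem polyProj_of_mem {d : ℤ} {p : MvPolynomial (Fin n) K} (hp : p ∈ polyComponent n K d) :
    polyProj d p = p := by
  unfold polyProj
  unfold polyComponent at hp
  split_ifs at hp ⊢
  · rw [homogeneousComponent_of_mem hp, if_pos rfl]
  · simpa using hp.symm

/-- Multiplication by `q` raises degrees by exactly `e`. This is what makes it possible to replace
arbitrary coefficients by homogeneous ones. -/
theorem polyProj_mul {d e : ℤ} (p : MvPolynomial (Fin n) K) {q : MvPolynomial (Fin n) K}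
    (hq : q ∈ polyComponent n K e) : polyProj d (p * q) = polyProj (d - e) p * q := by
  unfold polyComponent at hq
  split_ifs at hq with he
  · induction p using MvPolynomial.induction_on' with
    | monomial s c =>
      have h1 : monomial s c ∈ homogeneousSubmodule (Fin n) K s.degree :=
        isHomogeneous_monomial c rfl
      have h2 : monomial s c * q ∈ homogeneousSubmodule (Fin n) K (s.degree + e.toNat) :=
        IsHomogeneous.mul h1 hq
      unfold polyProj
      split_ifs with h3 h4 h4
      · rw [homogeneousComponent_of_mem h1, homogeneousComponent_of_mem h2]
        split_ifs <;> first | rfl | omega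
      · rw [homogeneousComponent_of_mem h2, if_neg (by omega)]
        simp
      · omega
      · simp
    | add p q hp hq => rw [add_mul, map_add, map_add, add_mul, hp, hq]
  · rw [(Submodule.mem_bot K).1 hq]
    simp

end PolyComponent

/-! ### Graded modules, relation modules and degree bounds -/

/-- A module over `K[x_1, …, x_n]` with homogeneous components indexed by `ℤ`. -/
structure GrMod (n : ℕ) (K : Type u) [Field K] where
  /-- the underlying module -/
  carrier : Type u
  [addCommGroup : AddCommGroup carrier]
  [module : Module (MvPolynomial (Fin n) K) carrier]
  /-- the homogeneous components -/
  comp : ℤ → AddSubgroup carrier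
  smul_mem : ∀ {e d : ℤ} {p : MvPolynomial (Fin n) K} {y : carrier},
    p ∈ polyComponent n K e → y ∈ comp d → p • y ∈ comp (e + d)

namespace GrMod

variable {n : ℕ} {K : Type u} [Field K]

instance : CoeSort (GrMod n K) (Type u) := ⟨carrier⟩

instance (M : GrMod n K) : AddCommGroup M := M.addCommGroup

instance (M : GrMod n K) : Module (MvPolynomial (Fin n) K) M := M.module

/-- The component of degree `d` of the graded free module with basis elements of degrees
`deg a`. -/
noncomputable def homog (n : ℕ) (K : Type u) [Field K] {κ : Type} (deg : κ → ℤ) (d : ℤ) :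
    AddSubgroup (κ → MvPolynomial (Fin n) K) where
  carrier := {c | ∀ a, c a ∈ polyComponent n K (d - deg a)}
  add_mem' := fun hx hy a => add_mem (hx a) (hy a)
  zero_mem' := fun _ => zero_mem _
  neg_mem' := fun hx a => neg_mem (hx a)

theorem smul_mem_homog {κ : Type} {deg : κ → ℤ} {e d : ℤ} {p : MvPolynomial (Fin n) K}
    {c : κ → MvPolynomial (Fin n) K} (hp : p ∈ polyComponent n K e) (hc : c ∈ homog n K deg d) :
    p • c ∈ homog n K deg (e + d) := fun a => by
  have := mul_mem_polyComponent hp (hc a)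
  rwa [← add_sub_assoc] at this

/-- The graded free module with basis elements of degrees `deg a`. -/
noncomputable abbrev free {κ : Type} (deg : κ → ℤ) : GrMod n K where
  carrier := κ → MvPolynomial (Fin n) K
  comp d := homog n K deg d
  smul_mem := smul_mem_homog

theorem single_mem_homog {κ : Type} [DecidableEq κ] (deg : κ → ℤ) (a : κ) :
    (Pi.single a 1 : κ → MvPolynomial (Fin n) K) ∈ homog n K deg (deg a) := by
  intro b
  by_cases h : b = a
  · subst h
    simpa using one_mem_polyComponent
  · simp [h]

/-- The linear map from a free module given by a family of elements. -/
noncomputable abbrev lin {M : GrMod n K} {κ : Type} [Fintype κ] (v : κ → M) :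
    (κ → MvPolynomial (Fin n) K) →ₗ[MvPolynomial (Fin n) K] M :=
  Fintype.linearCombination (MvPolynomial (Fin n) K) v

theorem lin_mem {M : GrMod n K} {κ : Type} [Fintype κ] {deg : κ → ℤ} {v : κ → M}
    (hv : ∀ a, v a ∈ M.comp (deg a)) {d : ℤ} {c : κ → MvPolynomial (Fin n) K}
    (hc : c ∈ homog n K deg d) : lin v c ∈ M.comp d := by
  rw [Fintype.linearCombination_apply]
  refine sum_mem fun a _ => ?_
  have := M.smul_mem (hc a) (hv a)
  rwa [sub_add_cancel] at this

theorem lin_sumElim {M : GrMod n K} {κ μ : Type} [Fintype κ] [Fintype μ] (v : κ → M) (w : μ → M)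
    (c : κ ⊕ μ → MvPolynomial (Fin n) K) :
    lin (Sum.elim v w) c = lin v (c ∘ Sum.inl) + lin w (c ∘ Sum.inr) := by
  simp [Fintype.linearCombination_apply, Fintype.sum_sum_type]

theorem map_lin {M N : GrMod n K} {κ : Type} [Fintype κ] (v : κ → M)
    (f : M →ₗ[MvPolynomial (Fin n) K] N) (c : κ → MvPolynomial (Fin n) K) :
    f (lin v c) = lin (f ∘ v) c := by
  simp [Fintype.linearCombination_apply]

/-- The module of relations of a family `v`, graded by giving the basis element `a` degree
`deg a`. -/
noncomputable abbrev syz {M : GrMod n K} {κ : Type} [Fintype κ] (deg : κ → ℤ) (v : κ → M) :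
    GrMod n K where
  carrier := LinearMap.ker (lin v)
  comp d := AddSubgroup.comap (LinearMap.ker (lin v)).subtype.toAddMonoidHom
    (homog n K deg d)
  smul_mem hp hy := smul_mem_homog hp hy

/-- The family `v` of homogeneous elements of degrees `deg a` generates all homogeneous
components of `M`. -/
structure IsCover (M : GrMod n K) {κ : Type} [Fintype κ] (deg : κ → ℤ) (v : κ → M) : Prop where
  mem : ∀ a, v a ∈ M.comp (deg a)
  surj : ∀ {d : ℤ} {y : M}, y ∈ M.comp d →
    ∃ c ∈ homog n K deg d, lin v c = y

/-- A short exact sequence `0 → A → B → C → 0` of graded modules; apart from injectivity,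
exactness is only asked for in each degree. -/
structure SES (A B C : GrMod n K) where
  /-- the map `A → B` -/
  f : A →ₗ[MvPolynomial (Fin n) K] B
  /-- the map `B → C` -/
  g : B →ₗ[MvPolynomial (Fin n) K] C
  inj : Function.Injective f
  f_mem : ∀ {d a}, a ∈ A.comp d → f a ∈ B.comp d
  g_mem : ∀ {d b}, b ∈ B.comp d → g b ∈ C.comp d
  g_f : ∀ a, g (f a) = 0
  exact : ∀ {d b}, b ∈ B.comp d → g b = 0 → ∃ a ∈ A.comp d, f a = b
  surj : ∀ {d c}, c ∈ C.comp d → ∃ b ∈ B.comp d, g b = c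

/-- The first `N` steps of some graded free resolution of `M` have generators of degrees at most
`m, m + 1, …, m + N - 1`. -/
def RegularTo : ℕ → ℤ → GrMod n K → Prop
  | 0, _, _ => True
  | N + 1, m, M => ∃ (κ : Type) (_ : Fintype κ) (deg : κ → ℤ) (v : κ → M),
      (∀ a, deg a ≤ m) ∧ M.IsCover deg v ∧ RegularTo N (m + 1) (syz deg v)

theorem RegularTo.mono {N : ℕ} {m m' : ℤ} {M : GrMod n K} (h : RegularTo N m M) (hm : m ≤ m') :
    RegularTo N m' M := by
  induction N generalizing m m' M with
  | zero => trivial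
  | succ N ih =>
    obtain ⟨κ, _, deg, v, hdeg, hv, hs⟩ := h
    exact ⟨κ, _, deg, v, fun a => (hdeg a).trans hm, hv, ih hs (by omega)⟩

theorem RegularTo.of_succ {N : ℕ} {m : ℤ} {M : GrMod n K} (h : RegularTo (N + 1) m M) :
    RegularTo N m M := by
  induction N generalizing m M with
  | zero => trivial
  | succ N ih =>
    obtain ⟨κ, _, deg, v, hdeg, hv, hs⟩ := h
    exact ⟨κ, _, deg, v, hdeg, hv, ih hs⟩

theorem regularTo_of_subsingleton (N : ℕ) (m : ℤ) (M : GrMod n K) [Subsingleton M] :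
    RegularTo N m M := by
  induction N generalizing m M with
  | zero => trivial
  | succ N ih =>
    refine ⟨Empty, inferInstance, Empty.elim, Empty.elim, fun a => a.elim,
      ⟨fun a => a.elim, fun _ => ⟨0, zero_mem _, Subsingleton.elim _ _⟩⟩, ?_⟩
    have : Subsingleton (syz (M := M) Empty.elim Empty.elim) :=
      ⟨fun a b => Subtype.ext (funext fun e => e.elim)⟩
    exact ih _ _

theorem lin_single_free {κ : Type} [Fintype κ] [DecidableEq κ] (deg : κ → ℤ)
    (c : κ → MvPolynomial (Fin n) K) :
    lin (M := free deg) (fun a => (Pi.single a 1 : κ → MvPolynomial (Fin n) K)) c = c := by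
  have h : ∀ c : κ → MvPolynomial (Fin n) K, Fintype.linearCombination (MvPolynomial (Fin n) K)
      (fun a => (Pi.single a 1 : κ → MvPolynomial (Fin n) K)) c = c := fun c => by
    rw [Fintype.linearCombination_apply]
    ext1 b
    simp [Finset.sum_apply, Pi.single_apply]
  exact h c

theorem regularTo_free {κ : Type} [Fintype κ] {deg : κ → ℤ} {m : ℤ} (hdeg : ∀ a, deg a ≤ m)
    (N : ℕ) : RegularTo N m (free deg : GrMod n K) := by
  classical
  cases N with
  | zero => trivial
  | succ N =>
    refine ⟨κ, _, deg, fun a => (Pi.single a 1 : κ → MvPolynomial (Fin n) K), hdeg,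
      ⟨single_mem_homog deg, fun {d y} hy => ⟨y, hy, lin_single_free deg y⟩⟩, ?_⟩
    have : Subsingleton (syz (M := (free deg : GrMod n K)) deg
        (fun a => (Pi.single a 1 : κ → MvPolynomial (Fin n) K))) := by
      refine ⟨fun a b => Subtype.ext ?_⟩
      have ha := LinearMap.mem_ker.1 a.2
      have hb := LinearMap.mem_ker.1 b.2
      rw [lin_single_free] at ha hb
      exact ha.trans hb.symm
    exact regularTo_of_subsingleton _ _ _

/-! ### The horseshoe lemma -/

/-- Extension by zero from the left summand of the index set. -/
noncomputable def extendInl (n : ℕ) (K : Type u) [Field K] (κ μ : Type) :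
    (κ → MvPolynomial (Fin n) K) →ₗ[MvPolynomial (Fin n) K] (κ ⊕ μ → MvPolynomial (Fin n) K) where
  toFun c := Sum.elim c 0
  map_add' c d := by ext1 (a | a) <;> simp
  map_smul' r c := by ext1 (a | a) <;> simp

/-- Extension by zero from the right summand of the index set. -/
noncomputable def extendInr (n : ℕ) (K : Type u) [Field K] (κ μ : Type) :
    (μ → MvPolynomial (Fin n) K) →ₗ[MvPolynomial (Fin n) K] (κ ⊕ μ → MvPolynomial (Fin n) K) where
  toFun c := Sum.elim 0 c
  map_add' c d := by ext1 (a | a) <;> simp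
  map_smul' r c := by ext1 (a | a) <;> simp

/-- The map of modules of relations induced by a map of free modules. -/
noncomputable def syzMap {M N : GrMod n K} {κ μ : Type} [Fintype κ] [Fintype μ] (deg : κ → ℤ)
    (v : κ → M) (deg' : μ → ℤ) (w : μ → N)
    (φ : (κ → MvPolynomial (Fin n) K) →ₗ[MvPolynomial (Fin n) K] (μ → MvPolynomial (Fin n) K))
    (h : ∀ c, lin v c = 0 → lin w (φ c) = 0) :
    syz deg v →ₗ[MvPolynomial (Fin n) K] syz deg' w :=
  φ.restrict (p := LinearMap.ker (lin v)) (q := LinearMap.ker (lin w)) h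

theorem syzMap_val {M N : GrMod n K} {κ μ : Type} [Fintype κ] [Fintype μ] {deg : κ → ℤ}
    {v : κ → M} {deg' : μ → ℤ} {w : μ → N}
    {φ : (κ → MvPolynomial (Fin n) K) →ₗ[MvPolynomial (Fin n) K] (μ → MvPolynomial (Fin n) K)}
    {h : ∀ c, lin v c = 0 → lin w (φ c) = 0} (c : syz deg v) :
    (syzMap deg v deg' w φ h c).1 = φ c.1 := rfl

theorem lin_val {M : GrMod n K} {κ : Type} [Fintype κ] {deg : κ → ℤ} {v : κ → M}
    (c : syz deg v) : lin v c.1 = 0 := c.2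

theorem sumElim_mem {κ μ : Type} {deg : κ → ℤ} {deg' : μ → ℤ} {d : ℤ}
    {c : κ → MvPolynomial (Fin n) K} {c' : μ → MvPolynomial (Fin n) K}
    (hc : c ∈ homog n K deg d) (hc' : c' ∈ homog n K deg' d) :
    Sum.elim c c' ∈ homog n K (Sum.elim deg deg') d := by
  rintro (a | a)
  · exact hc a
  · exact hc' a

/-- An element of `B` differs from a combination of the lifts `w` by an element of `A`. -/
theorem IsCover.sumElim {A B C : GrMod n K} (S : SES A B C) {κ μ : Type} [Fintype κ] [Fintype μ]
    {deg : κ → ℤ} {v : κ → A} {deg' : μ → ℤ} {w : μ → B} (hv : A.IsCover deg v)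
    (hw : ∀ b, w b ∈ B.comp (deg' b)) (hgw : C.IsCover deg' (S.g ∘ w)) :
    B.IsCover (Sum.elim deg deg') (Sum.elim (S.f ∘ v) w) where
  mem := by
    rintro (a | a)
    · exact S.f_mem (hv.mem a)
    · exact hw a
  surj {d y} hy := by
    obtain ⟨c, hc, hcy⟩ := hgw.surj (S.g_mem hy)
    obtain ⟨a, ha, hfa⟩ := S.exact (sub_mem hy (lin_mem hw hc))
      (by rw [map_sub, map_lin, hcy, sub_self])
    obtain ⟨e, he, rfl⟩ := hv.surj ha
    refine ⟨Sum.elim e c, sumElim_mem he hc, ?_⟩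
    rw [lin_sumElim, Sum.elim_comp_inl, Sum.elim_comp_inr, ← map_lin, hfa, sub_add_cancel]

/-- The exact sequence of relation modules in the horseshoe lemma. -/
noncomputable def SES.syz {A B C : GrMod n K} (S : SES A B C) {κ μ : Type} [Fintype κ]
    [Fintype μ] {deg : κ → ℤ} {v : κ → A} {deg' : μ → ℤ} {w : μ → B} (hv : A.IsCover deg v)
    (hw : ∀ b, w b ∈ B.comp (deg' b)) :
    SES (syz deg v) (syz (Sum.elim deg deg') (Sum.elim (S.f ∘ v) w)) (syz deg' (S.g ∘ w)) where
  f := syzMap _ _ _ _ (extendInl n K κ μ) fun c hc => by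
    rw [lin_sumElim]
    have h1 : extendInl n K κ μ c ∘ Sum.inl = c := rfl
    have h2 : extendInl n K κ μ c ∘ Sum.inr = 0 := rfl
    rw [h1, h2, ← map_lin, hc, map_zero, map_zero, add_zero]
  g := syzMap _ _ _ _ (LinearMap.funLeft _ _ Sum.inr) fun c hc => by
    have h1 : LinearMap.funLeft (MvPolynomial (Fin n) K) (MvPolynomial (Fin n) K)
      (Sum.inr : μ → κ ⊕ μ) c = c ∘ Sum.inr := rfl
    rw [lin_sumElim] at hc
    have := congrArg S.g hc
    rw [map_add, ← map_lin, S.g_f, zero_add, map_lin, map_zero] at this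
    rwa [h1]
  inj c c' h := by
    have h' := congrArg Subtype.val h
    rw [syzMap_val, syzMap_val] at h'
    exact Subtype.ext (funext fun a => congrFun h' (Sum.inl a))
  f_mem hc := sumElim_mem hc (zero_mem _)
  g_mem hc a := hc (Sum.inr a)
  g_f c := rfl
  exact {d b} hb h := by
    have h0 : b.1 ∘ Sum.inr = 0 := congrArg Subtype.val h
    have hl := lin_val b
    rw [lin_sumElim, h0, map_zero, add_zero, ← map_lin] at hl
    refine ⟨⟨b.1 ∘ Sum.inl, S.inj (hl.trans (map_zero _).symm)⟩, fun a => hb (Sum.inl a),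
      Subtype.ext ?_⟩
    rw [syzMap_val]
    ext1 (a | a)
    · rfl
    · exact (congrFun h0 a).symm
  surj {d c} hc := by
    have hz := lin_val c
    rw [← map_lin] at hz
    obtain ⟨a, ha, hfa⟩ := S.exact (lin_mem hw hc) hz
    obtain ⟨e, he, rfl⟩ := hv.surj ha
    -- The combination of the lifts `w` with coefficients `c` need not vanish in `B`, but it comes
    -- from `A`; the part `-e` cancels it.
    refine ⟨⟨Sum.elim (-e) c.1, ?_⟩, sumElim_mem (neg_mem he) hc, rfl⟩
    rw [LinearMap.mem_ker, lin_sumElim, Sum.elim_comp_inl, Sum.elim_comp_inr, map_neg,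
      ← map_lin, hfa]
    exact neg_add_cancel _

theorem SES.exists_lift {A B C : GrMod n K} (S : SES A B C) {μ : Type} [Fintype μ]
    {deg : μ → ℤ} {w : μ → C} (hw : ∀ a, w a ∈ C.comp (deg a)) :
    ∃ w' : μ → B, (∀ b, w' b ∈ B.comp (deg b)) ∧ S.g ∘ w' = w := by
  choose w' h1 h2 using fun b => S.surj (hw b)
  exact ⟨w', h1, funext h2⟩

/-- Regularity bounds pass to extensions. -/
theorem SES.regularTo_middle {A B C : GrMod n K} (S : SES A B C) {N : ℕ} {m : ℤ}
    (hA : RegularTo N m A) (hC : RegularTo N m C) : RegularTo N m B := by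
  induction N generalizing m A B C with
  | zero => trivial
  | succ N ih =>
    obtain ⟨κ, _, deg, v, hdeg, hv, hsv⟩ := hA
    obtain ⟨μ, _, deg', w, hdeg', hw, hsw⟩ := hC
    obtain ⟨w', hw', rfl⟩ := S.exists_lift hw.mem
    exact ⟨κ ⊕ μ, inferInstance, Sum.elim deg deg', Sum.elim (S.f ∘ v) w',
      by rintro (a | a); exacts [hdeg a, hdeg' a], hv.sumElim S hw' hw,
      ih (S.syz hv hw') hsv hsw⟩

/-! ### Cokernels and twists -/

theorem SES.isCover_g {A B C : GrMod n K} (S : SES A B C) {κ : Type} [Fintype κ] {deg : κ → ℤ}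
    {v : κ → B} (hv : B.IsCover deg v) : C.IsCover deg (S.g ∘ v) where
  mem a := S.g_mem (hv.mem a)
  surj {d y} hy := by
    obtain ⟨b, hb, rfl⟩ := S.surj hy
    obtain ⟨c, hc, rfl⟩ := hv.surj hb
    exact ⟨c, hc, (map_lin _ _ _).symm⟩

/-- The relations of generators of `B` embed into their relations in `C`, with cokernel `A`.
The exactness of `0 → A → B → C → 0` in degrees has to be complemented by exactness of the
underlying sequence. -/
noncomputable def SES.syzQuot {A B C : GrMod n K} (S : SES A B C)
    (hS : ∀ b, S.g b = 0 → b ∈ LinearMap.range S.f) {κ : Type} [Fintype κ] {deg : κ → ℤ}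
    {v : κ → B} (hv : B.IsCover deg v) :
    SES (GrMod.syz deg v) (GrMod.syz deg (S.g ∘ v)) A where
  f := syzMap _ _ _ _ LinearMap.id fun c hc => by
    rw [LinearMap.id_apply, ← map_lin, hc, map_zero]
  g := (LinearEquiv.ofInjective S.f S.inj).symm.toLinearMap ∘ₗ
    LinearMap.codRestrict (LinearMap.range S.f)
      (lin v ∘ₗ (LinearMap.ker (lin (S.g ∘ v))).subtype) fun c => hS _ <| by
        have := c.2
        rwa [LinearMap.mem_ker, ← map_lin] at this
  inj c c' h := by
    have h' := congrArg Subtype.val h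
    rw [syzMap_val, syzMap_val] at h'
    exact Subtype.ext h'
  f_mem hc := hc
  g_mem {d b} hb := by
    have hb' := lin_mem hv.mem hb
    have hz := lin_val b
    rw [← map_lin] at hz
    obtain ⟨a, ha, hfa⟩ := S.exact hb' hz
    convert ha
    rw [LinearMap.comp_apply, LinearEquiv.coe_coe, LinearEquiv.symm_apply_eq]
    exact Subtype.ext hfa.symm
  g_f c := by
    rw [LinearMap.comp_apply, LinearEquiv.coe_coe, LinearEquiv.symm_apply_eq]
    exact (Subtype.ext (lin_val c)).trans (map_zero (LinearEquiv.ofInjective S.f S.inj)).symm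
  exact {d b} hb h := by
    rw [LinearMap.comp_apply, LinearEquiv.coe_coe, LinearEquiv.symm_apply_eq, map_zero] at h
    exact ⟨⟨b.1, congrArg Subtype.val h⟩, hb, rfl⟩
  surj {d a} ha := by
    obtain ⟨c, hc, hca⟩ := hv.surj (S.f_mem ha)
    refine ⟨⟨c, ?_⟩, hc, ?_⟩
    · rw [LinearMap.mem_ker, ← map_lin, hca, S.g_f]
    · rw [LinearMap.comp_apply, LinearEquiv.coe_coe, LinearEquiv.symm_apply_eq]
      exact Subtype.ext hca

/-- Regularity bounds pass to cokernels. -/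
theorem SES.regularTo_right {A B C : GrMod n K} (S : SES A B C)
    (hS : ∀ b, S.g b = 0 → b ∈ LinearMap.range S.f) {N : ℕ} {m : ℤ}
    (hA : RegularTo N (m + 1) A) (hB : RegularTo N m B) : RegularTo N m C := by
  cases N with
  | zero => trivial
  | succ N =>
    obtain ⟨κ, _, deg, v, hdeg, hv, hsv⟩ := hB
    exact ⟨κ, _, deg, S.g ∘ v, hdeg, S.isCover_g hv,
      (S.syzQuot hS hv).regularTo_middle hsv hA.of_succ⟩

/-- The twist by `e`: the component of degree `d` is the component of degree `d - e` of `M`. -/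
abbrev shift (M : GrMod n K) (e : ℤ) : GrMod n K where
  carrier := M
  comp d := M.comp (d - e)
  smul_mem hp hy := by
    rw [add_sub_assoc]
    exact M.smul_mem hp hy

/-- The same coefficients resolve both modules: transporting generators along `φ` leaves the kernel
of relations unchanged and only moves the basis degrees by `e`. -/
theorem RegularTo.of_equiv {N : ℕ} {m : ℤ} {A B : GrMod n K} (h : RegularTo N m A) (e : ℤ)
    (φ : A ≃ₗ[MvPolynomial (Fin n) K] B) (hφ : ∀ d a, φ a ∈ B.comp (d + e) ↔ a ∈ A.comp d) :
    RegularTo N (m + e) B := by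
  induction N generalizing m A B with
  | zero => trivial
  | succ N ih =>
    obtain ⟨κ, _, deg, v, hdeg, hv, hs⟩ := h
    refine ⟨κ, _, fun a => deg a + e, φ ∘ v, fun a => by linarith [hdeg a],
      ⟨fun a => (hφ _ _).2 (hv.mem a), fun {d y} hy => ?_⟩, ?_⟩
    · obtain ⟨a, rfl⟩ := φ.surjective y
      rw [← sub_add_cancel d e, hφ] at hy
      obtain ⟨c, hc, rfl⟩ := hv.surj hy
      refine ⟨c, fun a => ?_, (map_lin v φ.toLinearMap c).symm⟩
      have := hc a
      rwa [show d - (deg a + e) = d - e - deg a by ring]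
    · have hker : LinearMap.ker (lin v) = LinearMap.ker (lin (φ ∘ v)) := by
        ext c
        have : lin (φ ∘ v) c = φ (lin v c) := (map_lin v φ.toLinearMap c).symm
        rw [LinearMap.mem_ker, LinearMap.mem_ker, this, LinearEquiv.map_eq_zero_iff]
      have := ih hs (B := GrMod.syz (fun a => deg a + e) (φ ∘ v))
        (LinearEquiv.ofEq _ _ hker) fun d c => forall_congr' fun a => by
          rw [show d + e - (deg a + e) = d - deg a by ring]
          rfl
      rwa [show m + e + 1 = m + 1 + e by ring]

theorem RegularTo.shift {N : ℕ} {m : ℤ} {M : GrMod n K} (h : RegularTo N m M) (e : ℤ) :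
    RegularTo N (m + e) (M.shift e) :=
  h.of_equiv e (LinearEquiv.refl _ _) fun d a => by
    change a ∈ M.comp (d + e - e) ↔ _
    rw [add_sub_cancel_right]

/-! ### Comparison of a minimal resolution with an arbitrary one -/

theorem comp_mem_homog_inl {κ μ : Type} {deg : κ → ℤ} {deg' : μ → ℤ} {d : ℤ}
    {c : κ ⊕ μ → MvPolynomial (Fin n) K} (hc : c ∈ homog n K (Sum.elim deg deg') d) :
    c ∘ Sum.inl ∈ homog n K deg d := fun a => hc (Sum.inl a)

theorem comp_mem_homog_inr {κ μ : Type} {deg : κ → ℤ} {deg' : μ → ℤ} {d : ℤ}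
    {c : κ ⊕ μ → MvPolynomial (Fin n) K} (hc : c ∈ homog n K (Sum.elim deg deg') d) :
    c ∘ Sum.inr ∈ homog n K deg' d := fun a => hc (Sum.inr a)

/-- The relations of `u` and `w` together, compared with the relations of a generating
family `w`. -/
noncomputable def sesOfIsCover {M : GrMod n K} {κ μ : Type} [Fintype κ] [Fintype μ] {deg : κ → ℤ}
    {u : κ → M} {deg' : μ → ℤ} {w : μ → M} (hu : ∀ a, u a ∈ M.comp (deg a))
    (hw : M.IsCover deg' w) :
    SES (syz deg' w) (syz (Sum.elim deg deg') (Sum.elim u w)) (free deg) where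
  f := syzMap _ _ _ _ (extendInr n K κ μ) fun c hc => by
    rw [lin_sumElim]
    have h1 : extendInr n K κ μ c ∘ Sum.inl = 0 := rfl
    have h2 : extendInr n K κ μ c ∘ Sum.inr = c := rfl
    rw [h1, h2, hc, map_zero, add_zero]
  g := LinearMap.funLeft _ _ Sum.inl ∘ₗ (LinearMap.ker (lin (Sum.elim u w))).subtype
  inj c c' h := by
    have h' := congrArg Subtype.val h
    rw [syzMap_val, syzMap_val] at h'
    exact Subtype.ext (funext fun a => congrFun h' (Sum.inr a))
  f_mem hc := sumElim_mem (zero_mem _) hc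
  g_mem hc := comp_mem_homog_inl hc
  g_f c := rfl
  exact {d b} hb h := by
    have h0 : b.1 ∘ Sum.inl = 0 := h
    have hl := lin_val b
    rw [lin_sumElim, h0, map_zero, zero_add] at hl
    refine ⟨⟨b.1 ∘ Sum.inr, hl⟩, comp_mem_homog_inr hb, Subtype.ext ?_⟩
    rw [syzMap_val]
    ext1 (a | a)
    · exact (congrFun h0 a).symm
    · rfl
  surj {d c} hc := by
    obtain ⟨e, he, hec⟩ := hw.surj (lin_mem hu hc)
    refine ⟨⟨Sum.elim c (-e), ?_⟩, sumElim_mem hc (neg_mem he), rfl⟩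
    rw [LinearMap.mem_ker, lin_sumElim, Sum.elim_comp_inl, Sum.elim_comp_inr, map_neg, hec,
      add_neg_cancel]

/-- Lifts of a basis of the free quotient bring no new relations: applying `S.g` reads off their
coefficients, which must therefore vanish. -/
theorem relation_of_extension {Z Y : GrMod n K} {η : Type} [Fintype η] [DecidableEq η]
    {hd : η → ℤ} (S : SES Z Y (free hd)) {h : η → Y} (hg : S.g ∘ h = fun b => Pi.single b 1)
    {κ : Type} [Fintype κ] {v : κ → Z} {c : κ ⊕ η → MvPolynomial (Fin n) K}
    (hc : lin (Sum.elim (S.f ∘ v) h) c = 0) :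
    c ∘ Sum.inr = 0 ∧ lin v (c ∘ Sum.inl) = 0 := by
  rw [lin_sumElim, ← map_lin] at hc
  have h1 := congrArg S.g hc
  rw [map_add, S.g_f, zero_add, map_lin, hg, lin_single_free, map_zero] at h1
  rw [h1, map_zero, add_zero] at hc
  exact ⟨h1, S.inj (hc.trans (map_zero _).symm)⟩

/-- The relations of generators `v` of `Z`, compared with the relations of generators of
an extension `Y` of a free module by `Z`. -/
noncomputable def sesOfExtension {Z Y : GrMod n K} {η : Type} [Fintype η] [DecidableEq η]
    {hd : η → ℤ} (S : SES Z Y (free hd)) {h : η → Y}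
    (hg : S.g ∘ h = fun b => Pi.single b 1) {κ μ : Type} [Fintype κ] [Fintype μ]
    {deg : κ → ℤ} {v : κ → Z} (hu : Y.IsCover (Sum.elim deg hd) (Sum.elim (S.f ∘ v) h))
    {deg' : μ → ℤ} {w : μ → Y} (hw : ∀ b, w b ∈ Y.comp (deg' b)) :
    SES (syz deg v) (syz (Sum.elim (Sum.elim deg hd) deg')
      (Sum.elim (Sum.elim (S.f ∘ v) h) w)) (free deg') where
  f := syzMap _ _ _ _ (extendInl n K (κ ⊕ η) μ ∘ₗ extendInl n K κ η) fun c hc => by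
    rw [lin_sumElim]
    have h1 : ((extendInl n K (κ ⊕ η) μ ∘ₗ extendInl n K κ η) c) ∘ Sum.inl =
      extendInl n K κ η c := rfl
    have h2 : ((extendInl n K (κ ⊕ η) μ ∘ₗ extendInl n K κ η) c) ∘ Sum.inr = 0 := rfl
    have h3 : extendInl n K κ η c ∘ Sum.inl = c := rfl
    have h4 : extendInl n K κ η c ∘ Sum.inr = 0 := rfl
    rw [h1, h2, map_zero, add_zero, lin_sumElim, h3, h4, map_zero, add_zero, ← map_lin, hc,
      map_zero]
  g := LinearMap.funLeft _ _ Sum.inr ∘ₗ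
    (LinearMap.ker (lin (Sum.elim (Sum.elim (S.f ∘ v) h) w))).subtype
  inj c c' h := by
    have h' := congrArg Subtype.val h
    rw [syzMap_val, syzMap_val] at h'
    exact Subtype.ext (funext fun a => congrFun h' (Sum.inl (Sum.inl a)))
  f_mem hc := sumElim_mem (sumElim_mem hc (zero_mem _)) (zero_mem _)
  g_mem hc := comp_mem_homog_inr hc
  g_f c := rfl
  exact {d b} hb h := by
    have h0 : b.1 ∘ Sum.inr = 0 := h
    have hl := lin_val b
    rw [lin_sumElim, h0, map_zero, add_zero] at hl
    obtain ⟨h1, h2⟩ := relation_of_extension S hg hl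
    refine ⟨⟨(b.1 ∘ Sum.inl) ∘ Sum.inl, h2⟩, comp_mem_homog_inl (comp_mem_homog_inl hb),
      Subtype.ext ?_⟩
    rw [syzMap_val]
    ext1 ((a | a) | a)
    · rfl
    · exact (congrFun h1 a).symm
    · exact (congrFun h0 a).symm
  surj {d c} hc := by
    obtain ⟨e, he, hec⟩ := hu.surj (lin_mem hw hc)
    refine ⟨⟨Sum.elim (-e) c, ?_⟩, sumElim_mem (neg_mem he) hc, rfl⟩
    rw [LinearMap.mem_ker, lin_sumElim, Sum.elim_comp_inl, Sum.elim_comp_inr, map_neg, hec,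
      neg_add_cancel]

theorem one_notMem_idealOfVars : (1 : MvPolynomial (Fin n) K) ∉ idealOfVars (Fin n) K := by
  rw [idealOfVars, ← Set.image_univ, mem_ideal_span_X_image]
  simp

/-- Minimal generators have degrees at most those of any generators, here also after adding a free
module. -/
theorem deg_le_of_isCover {Z Y : GrMod n K} {η : Type} [Fintype η] [DecidableEq η]
    {hd : η → ℤ} (S : SES Z Y (free hd)) {h : η → Y}
    (hg : S.g ∘ h = fun b => Pi.single b 1) {κ μ : Type} [Fintype κ] [Fintype μ]
    {deg : κ → ℤ} {v : κ → Z} (hv : ∀ a, v a ∈ Z.comp (deg a))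
    (hmin : ∀ c, lin v c = 0 → ∀ a, c a ∈ idealOfVars (Fin n) K)
    (hu : Y.IsCover (Sum.elim deg hd) (Sum.elim (S.f ∘ v) h))
    {deg' : μ → ℤ} {w : μ → Y} (hw : Y.IsCover deg' w) {m : ℤ} (hm : ∀ b, deg' b ≤ m) (a : κ) :
    deg a ≤ m := by
  classical
  by_contra! hlt
  obtain ⟨c, hc, hca⟩ := hw.surj (S.f_mem (hv a))
  choose t _ ht using fun b => hu.surj (hw.mem b)
  -- Rewriting `S.f (v a)` through `w` and then back through the generators of `Y` gives a relation
  -- among the latter. If `deg a > m`, the detour has coefficients in the maximal ideal, so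
  -- minimality would put `1` there.
  have hz : lin (Sum.elim (S.f ∘ v) h) (Pi.single (Sum.inl a) 1 - ∑ b, c b • t b) = 0 := by
    rw [map_sub, map_sum, Fintype.linearCombination_apply_single, one_smul, Sum.elim_inl,
      Function.comp_apply, ← hca, Fintype.linearCombination_apply, sub_eq_zero]
    exact Finset.sum_congr rfl fun b _ => by rw [map_smul, ht]
  have h1 := hmin _ (relation_of_extension S hg hz).2 a
  have h2 : (∑ b, c b • t b) (Sum.inl a) ∈ idealOfVars (Fin n) K := by
    rw [Finset.sum_apply]
    refine sum_mem fun b _ => Ideal.mul_mem_right _ _ ?_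
    exact polyComponent_le_idealOfVars (by linarith [hm b]) (hc b)
  have h3 := add_mem h1 h2
  rw [Function.comp_apply, Pi.sub_apply, sub_add_cancel, Pi.single_eq_same] at h3
  exact one_notMem_idealOfVars h3

/-- One step of the comparison of a minimal resolution with an arbitrary one. -/
theorem RegularTo.compare_step {Z Y : GrMod n K} {η : Type} [Fintype η] {hd : η → ℤ}
    (S : SES Z Y (free hd)) {N : ℕ} {m : ℤ} (hm : ∀ b, hd b ≤ m) (hY : RegularTo (N + 1) m Y)
    {κ : Type} [Fintype κ] {deg : κ → ℤ} {v : κ → Z} (hv : Z.IsCover deg v)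
    (hmin : ∀ c, lin v c = 0 → ∀ a, c a ∈ idealOfVars (Fin n) K) :
    (∀ a, deg a ≤ m) ∧ ∃ (μ : Type) (_ : Fintype μ) (deg' : μ → ℤ) (X : GrMod n K)
      (_ : SES (syz deg v) X (free deg')), (∀ b, deg' b ≤ m + 1) ∧ RegularTo N (m + 1) X := by
  classical
  obtain ⟨μ, _, deg', w, hdeg', hw, hs⟩ := hY
  obtain ⟨h, hh, hg⟩ := S.exists_lift (w := fun b => (Pi.single b 1 : η → MvPolynomial (Fin n) K))
    (single_mem_homog hd)
  have hu : Y.IsCover (Sum.elim deg hd) (Sum.elim (S.f ∘ v) h) := by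
    refine hv.sumElim S hh ?_
    rw [hg]
    exact ⟨single_mem_homog hd, fun {d y} hy => ⟨y, hy, lin_single_free hd y⟩⟩
  have hdeg := deg_le_of_isCover S hg hv.mem hmin hu hw hdeg'
  -- As in Schanuel's lemma, the relations of both generating families of `Y` together are read in
  -- two ways: as an extension of `free deg'` by the relations of `v`, the new comparison, and as an
  -- extension of a free module by the relations of `w`, which bounds them.
  refine ⟨hdeg, μ, inferInstance, deg', _, sesOfExtension S hg hu hw.mem,
    fun b => (hdeg' b).trans (by omega),
    (sesOfIsCover hu.mem hw).regularTo_middle hs (regularTo_free ?_ N)⟩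
  rintro (a | a)
  exacts [(hdeg a).trans (by omega), (hm a).trans (by omega)]

theorem lin_map_single {M : GrMod n K} {κ : Type} [Fintype κ] [DecidableEq κ]
    (φ : (κ → MvPolynomial (Fin n) K) →ₗ[MvPolynomial (Fin n) K] M) :
    lin (fun a => φ (Pi.single a 1)) = φ :=
  LinearMap.ext fun c => by
    have := map_lin (M := free (fun _ : κ => 0))
      (fun a => (Pi.single a 1 : κ → MvPolynomial (Fin n) K)) φ c
    rw [lin_single_free] at this
    exact this.symm

/-- A bound for the generator degrees of any resolution of `Z` bounds the generator degrees of a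
minimal one; the bound may be given for an extension `Y` of a free module by `Z`. -/
theorem RegularTo.deg_le {N : ℕ} {Z Y : GrMod n K} {η : Type} [Fintype η] {hd : η → ℤ}
    (S : SES Z Y (free hd)) {m : ℤ} (hm : ∀ b, hd b ≤ m) (hY : RegularTo N m Y)
    {rank : ℕ → ℕ} {deg : ∀ i, Fin (rank i) → ℤ}
    {diff : ∀ i, (Fin (rank (i + 1)) → MvPolynomial (Fin n) K) →ₗ[MvPolynomial (Fin n) K]
      (Fin (rank i) → MvPolynomial (Fin n) K)}
    {aug : (Fin (rank 0) → MvPolynomial (Fin n) K) →ₗ[MvPolynomial (Fin n) K] Z}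
    (haug : Z.IsCover (deg 0) fun a => aug (Pi.single a 1))
    (hdiff : ∀ i b, diff i (Pi.single b 1) ∈ homog n K (deg i) (deg (i + 1) b))
    (hlift : ∀ i d y, diff i y ∈ homog n K (deg i) d →
      ∃ y' ∈ homog n K (deg (i + 1)) d, diff i y' = diff i y)
    (hex : ∀ i, Function.Exact (diff (i + 1)) (diff i)) (hex0 : Function.Exact (diff 0) aug)
    (hmin : ∀ i v a, diff i v a ∈ idealOfVars (Fin n) K) {i : ℕ} (hi : i < N)
    (a : Fin (rank i)) : deg i a ≤ m + i := by
  induction N generalizing Z Y η m rank i with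
  | zero => omega
  | succ N ih =>
    obtain ⟨h0, μ, _, deg', X, S', hdeg', hX⟩ := hY.compare_step S hm haug fun c hc a => by
      rw [lin_map_single] at hc
      obtain ⟨y, rfl⟩ := (hex0 c).1 hc
      exact hmin 0 y a
    cases i with
    | zero => simpa using h0 a
    | succ i =>
      have hmem : ∀ y, diff 0 y ∈ LinearMap.ker (lin fun a => aug (Pi.single a 1)) := fun y => by
        rw [lin_map_single]
        exact hex0.apply_apply_eq_zero y
      have hzero : ∀ y, (diff 0).codRestrict _ hmem y = 0 ↔ diff 0 y = 0 := fun y => by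
        rw [← Subtype.coe_inj]
        rfl
      -- The resolution with its first term removed resolves the relation module, with `diff 0` as
      -- augmentation.
      have := ih S' hdeg' hX (rank := fun i => rank (i + 1)) (deg := fun i => deg (i + 1))
        (diff := fun i => diff (i + 1)) (aug := (diff 0).codRestrict _ hmem)
        ⟨hdiff 0, fun {d y} hy => by
          obtain ⟨x, hx⟩ := (hex0 y.1).1 (by simpa only [lin_map_single] using lin_val y)
          obtain ⟨x', hx', he⟩ := hlift 0 d x (by rw [hx]; exact hy)
          refine ⟨x', hx', ?_⟩
          rw [lin_map_single]
          exact Subtype.ext (he.trans hx)⟩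
        (fun i => hdiff (i + 1)) (fun i => hlift (i + 1)) (fun i => hex (i + 1))
        (fun y => (hzero y).trans (hex 0 y)) (fun i => hmin (i + 1)) (i := i) (by omega) a
      push_cast
      linarith

/-- A graded module as an extension of the free module of rank zero. -/
noncomputable def sesSelf (M : GrMod n K) : SES M M (free (Empty.elim : Empty → ℤ)) where
  f := LinearMap.id
  g := 0
  inj _ _ h := h
  f_mem h := h
  g_mem _ := zero_mem _
  g_f _ := rfl
  exact {_ b} hb _ := ⟨b, hb, rfl⟩
  surj _ := ⟨0, zero_mem _, funext fun a => a.elim⟩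

/-- Homogeneous preimages under a homogeneous map of graded free modules. -/
theorem exists_homog_preimage {κ μ : Type} [Fintype κ] [DecidableEq κ] {deg : κ → ℤ}
    {deg' : μ → ℤ}
    {φ : (κ → MvPolynomial (Fin n) K) →ₗ[MvPolynomial (Fin n) K] (μ → MvPolynomial (Fin n) K)}
    (hφ : ∀ b, φ (Pi.single b 1) ∈ homog n K deg' (deg b)) {d : ℤ}
    {y : κ → MvPolynomial (Fin n) K} (hy : φ y ∈ homog n K deg' d) :
    ∃ y' ∈ homog n K deg d, φ y' = φ y := by
  have key : ∀ c a, φ c a = ∑ b, c b * φ (Pi.single b 1) a := fun c a => by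
    conv_lhs => rw [← lin_map_single (M := free deg') φ, Fintype.linearCombination_apply,
      Finset.sum_apply]
    rfl
  -- Keeping in each coefficient only the degree that contributes to degree `d` does not change the
  -- degree `d` part of the image.
  refine ⟨fun b => polyProj (d - deg b) (y b), fun b => polyProj_mem _ _, funext fun a => ?_⟩
  rw [← polyProj_of_mem (hy a), key, key, map_sum]
  refine Finset.sum_congr rfl fun b _ => ?_
  rw [polyProj_mul _ (hφ b a), show d - deg' a - (deg b - deg' a) = d - deg b by ring]

/-! ### Quotients by homogeneous ideals and their regularity -/

/-- The graded module `R / I`. -/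
noncomputable abbrev quot (I : Ideal (MvPolynomial (Fin n) K)) : GrMod n K where
  carrier := MvPolynomial (Fin n) K ⧸ I
  comp d := (quotientComponent I d).toAddSubgroup
  smul_mem := by
    rintro e d p _ hp ⟨q, hq, rfl⟩
    exact ⟨p * q, mul_mem_polyComponent hp hq, rfl⟩

theorem mem_quot_comp {I : Ideal (MvPolynomial (Fin n) K)} {d : ℤ} {y : quot I} :
    y ∈ (quot I).comp d ↔ ∃ q ∈ polyComponent n K d, Ideal.Quotient.mk I q = y :=
  Iff.rfl

/-- A bound for the generator degrees of all initial parts of resolutions bounds the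
regularity. -/
theorem regularity_le {I : Ideal (MvPolynomial (Fin n) K)}
    (hI : ∀ f ∈ I, ∀ d : ℤ, polyProj d f ∈ I) {m : ℤ} (h : ∀ N, RegularTo N m (quot I)) :
    castelnuovoMumfordRegularity n (quotientComponent I) ≤ ((m : ℝ) : EReal) := by
  refine sSup_le ?_
  rintro _ ⟨F, hF, i, j, hij, rfl⟩
  obtain ⟨a, ha⟩ := Finset.card_ne_zero.1 hij
  have hdiff : ∀ i b, F.diff i (Pi.single b 1) ∈ homog n K (F.deg i) (F.deg (i + 1) b) :=
    fun i b a => F.diff_mem i b a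
  have hcover : (quot I).IsCover (F.deg 0) fun a => F.aug (Pi.single a 1) := by
    refine ⟨F.aug_mem, fun {d y} hy => ?_⟩
    obtain ⟨q, hq, rfl⟩ := mem_quot_comp.1 hy
    obtain ⟨c, hc⟩ := F.aug_surjective (Ideal.Quotient.mk I q)
    choose p hp hpa using fun a => mem_quot_comp.1 (F.aug_mem a)
    have hlin : ∀ c, lin (M := quot I) (fun a => F.aug (Pi.single a 1)) c =
        Ideal.Quotient.mk I (∑ a, c a * p a) := fun c => by
      rw [Fintype.linearCombination_apply, map_sum]
      refine Finset.sum_congr rfl fun a _ => ?_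
      rw [← hpa]
      rfl
    -- Surjectivity of `F.aug` gives coefficients without degree control. Since `I` is homogeneous,
    -- the congruence modulo `I` can be restricted to degree `d`.
    refine ⟨fun a => polyProj (d - F.deg 0 a) (c a), fun a => polyProj_mem _ _, ?_⟩
    have h1 : Ideal.Quotient.mk I (∑ a, c a * p a) = Ideal.Quotient.mk I q := by
      rw [← hlin, ← hc, lin_map_single (M := quot I)]
    rw [hlin, Ideal.Quotient.eq]
    have h2 := hI _ (Ideal.Quotient.eq.1 h1) d
    rw [map_sub, polyProj_of_mem hq, map_sum] at h2
    convert h2 using 3 with a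
    exact (polyProj_mul _ (hp a)).symm
  -- The comparison starts with `Y = Z = R / I`; reaching step `i` requires `i + 1` steps of the
  -- bounded resolution.
  have := (h (i + 1)).deg_le (sesSelf _) (fun b => b.elim) (aug := F.aug) hcover hdiff
    (fun i d y hy => exists_homog_preimage (hdiff i) hy) F.exact_succ F.exact_zero hF
    (Nat.lt_succ_self i) a
  rw [(Finset.mem_filter.1 ha).2] at this
  exact_mod_cast (by omega : j - i ≤ m)

theorem polyProj_X_mul {x : Fin n} {d : ℤ} (s : MvPolynomial (Fin n) K) :
    polyProj d (X x * s) = X x * polyProj (d - 1) s := by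
  rw [mul_comm, polyProj_mul _ (X_mem_polyComponent x), mul_comm]

/-- The exact sequence `0 → (R / (I : x))(-1) → R / I → R / (I, x) → 0`. -/
noncomputable def sesQuot {I A C : Ideal (MvPolynomial (Fin n) K)} {x : Fin n}
    (hI : ∀ f ∈ I, ∀ d : ℤ, polyProj d f ∈ I) (hA : ∀ f, X x * f ∈ I ↔ f ∈ A) (hIC : I ≤ C)
    (hx : X x ∈ C) (hC : ∀ f ∈ C, ∃ g ∈ I, ∃ h, f = g + X x * h) :
    SES ((quot A).shift 1) (quot I) (quot C) where
  f := Submodule.mapQ A I (LinearMap.mulLeft (MvPolynomial (Fin n) K) (X x))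
    fun f hf => (hA f).2 hf
  g := Submodule.mapQ I C LinearMap.id hIC
  inj := by
    refine (injective_iff_map_eq_zero _).2 fun a ha => ?_
    obtain ⟨f, rfl⟩ := Ideal.Quotient.mk_surjective a
    exact Ideal.Quotient.eq_zero_iff_mem.2 ((hA f).1 (Ideal.Quotient.eq_zero_iff_mem.1 ha))
  f_mem {d} := by
    rintro _ ⟨q, hq, rfl⟩
    refine ⟨X x * q, ?_, rfl⟩
    have := mul_mem_polyComponent (X_mem_polyComponent x) hq
    rwa [add_sub_cancel] at this
  g_mem {d} := by
    rintro _ ⟨q, hq, rfl⟩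
    exact ⟨q, hq, rfl⟩
  g_f a := by
    obtain ⟨f, rfl⟩ := Ideal.Quotient.mk_surjective a
    exact Ideal.Quotient.eq_zero_iff_mem.2 (C.mul_mem_right f hx)
  exact {d} := by
    rintro _ ⟨q, hq, rfl⟩ h
    obtain ⟨i, hi, s, hs⟩ := hC q (Ideal.Quotient.eq_zero_iff_mem.1 h)
    have hq' := polyProj_of_mem hq
    rw [hs, map_add, polyProj_X_mul, ← hs] at hq'
    refine ⟨Ideal.Quotient.mk A (polyProj (d - 1) s), ⟨_, polyProj_mem _ _, rfl⟩,
      Ideal.Quotient.eq.2 ?_⟩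
    have : X x * polyProj (d - 1) s - q = -polyProj d i := by rw [← hq']; ring
    exact this ▸ neg_mem (hI i hi d)
  surj {d} := by
    rintro _ ⟨q, hq, rfl⟩
    exact ⟨Ideal.Quotient.mk I q, ⟨q, hq, rfl⟩, rfl⟩

/-- Exactness for inhomogeneous elements too, as `SES.regularTo_right` requires. -/
theorem sesQuot_exact {I A C : Ideal (MvPolynomial (Fin n) K)} {x : Fin n}
    (hI : ∀ f ∈ I, ∀ d : ℤ, polyProj d f ∈ I) (hA : ∀ f, X x * f ∈ I ↔ f ∈ A) (hIC : I ≤ C)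
    (hx : X x ∈ C) (hC : ∀ f ∈ C, ∃ g ∈ I, ∃ h, f = g + X x * h) (b : quot I)
    (hb : (sesQuot hI hA hIC hx hC).g b = 0) :
    b ∈ LinearMap.range (sesQuot hI hA hIC hx hC).f := by
  obtain ⟨q, rfl⟩ := Ideal.Quotient.mk_surjective b
  obtain ⟨i, hi, s, rfl⟩ := hC q (Ideal.Quotient.eq_zero_iff_mem.1 hb)
  refine ⟨Ideal.Quotient.mk A s, Ideal.Quotient.eq.2 ?_⟩
  have : X x * s - (i + X x * s) = -i := by ring
  exact this ▸ neg_mem hi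

/-! ### Intersections of primes generated by variables -/

/-- The intersection of the prime ideals generated by the sets of variables in `s`. -/
noncomputable def varIdeal (K : Type u) [Field K] (s : Finset (Finset (Fin n))) :
    Ideal (MvPolynomial (Fin n) K) :=
  ⨅ T ∈ s, Ideal.span (X '' (T : Set (Fin n)))

/-- A monomial lies in a prime generated by variables exactly when one of these variables divides
it, and membership is tested monomial by monomial. -/
theorem mem_varIdeal {s : Finset (Finset (Fin n))} {f : MvPolynomial (Fin n) K} :
    f ∈ varIdeal K s ↔ ∀ m ∈ f.support, ∀ T ∈ s, ∃ i ∈ T, m i ≠ 0 := by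
  simp only [varIdeal, Submodule.mem_iInf, mem_ideal_span_X_image, Finset.mem_coe]
  exact ⟨fun h m hm T hT => h T hT m hm, fun h T hT m hm => h m hm T hT⟩

theorem polyProj_mem_varIdeal {s : Finset (Finset (Fin n))} {f : MvPolynomial (Fin n) K}
    (hf : f ∈ varIdeal K s) (d : ℤ) : polyProj d f ∈ varIdeal K s := by
  unfold polyProj
  split_ifs
  · rw [mem_varIdeal] at hf ⊢
    intro m hm
    refine hf m ?_
    rw [mem_support_iff, coeff_homogeneousComponent] at hm
    rw [mem_support_iff]
    exact fun h => hm (by simp [h])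
  · exact zero_mem _

/-- A set containing `x` imposes no condition on multiples of `x`; for any other set the factor `x`
is irrelevant. -/
theorem X_mul_mem_varIdeal {s : Finset (Finset (Fin n))} {x : Fin n}
    (f : MvPolynomial (Fin n) K) :
    X x * f ∈ varIdeal K s ↔ f ∈ varIdeal K (s.filter (x ∉ ·)) := by
  simp only [mem_varIdeal, support_X_mul, Finset.mem_map, addLeftEmbedding_apply,
    forall_exists_index, and_imp, forall_apply_eq_imp_iff₂, Finset.mem_filter]
  refine forall₂_congr fun m _ => forall₂_congr fun T _ => ?_
  constructor
  · rintro ⟨i, hi, h⟩ hx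
    refine ⟨i, hi, ?_⟩
    have : x ≠ i := fun e => hx (e ▸ hi)
    simpa [Finsupp.single_apply, this] using h
  · intro h
    by_cases hx : x ∈ T
    · exact ⟨x, hx, by simp⟩
    · obtain ⟨i, hi, hm⟩ := h hx
      exact ⟨i, hi, by simp [hm]⟩

theorem varIdeal_le_image_insert (s : Finset (Finset (Fin n))) (x : Fin n) :
    varIdeal K s ≤ varIdeal K (s.image (insert x)) := by
  intro f hf
  rw [mem_varIdeal] at hf ⊢
  simp only [Finset.mem_image, forall_exists_index, and_imp, forall_apply_eq_imp_iff₂]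
  intro m hm T hT
  obtain ⟨i, hi, h⟩ := hf m hm T hT
  exact ⟨i, Finset.mem_insert_of_mem hi, h⟩

theorem X_mem_varIdeal_image_insert (s : Finset (Finset (Fin n))) (x : Fin n) :
    X x ∈ varIdeal K (s.image (insert x)) := by
  rw [mem_varIdeal]
  simp only [Finset.mem_image, forall_exists_index, and_imp, forall_apply_eq_imp_iff₂]
  intro m hm T hT
  rw [support_X, Finset.mem_singleton] at hm
  exact ⟨x, Finset.mem_insert_self _ _, by simp [hm]⟩

theorem exists_add_of_mem_varIdeal_image_insert (s : Finset (Finset (Fin n))) (x : Fin n)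
    (f : MvPolynomial (Fin n) K) (hf : f ∈ varIdeal K (s.image (insert x))) :
    ∃ g ∈ varIdeal K s, ∃ h, f = g + X x * h := by
  suffices f ∈ varIdeal K s ⊔ Ideal.span {X x} by
    obtain ⟨g, hg, y, hy, rfl⟩ := Submodule.mem_sup.1 this
    obtain ⟨h, rfl⟩ := Ideal.mem_span_singleton.1 hy
    exact ⟨g, hg, h, rfl⟩
  rw [f.as_sum]
  refine sum_mem fun m hm => ?_
  -- A monomial free of `x` must meet each `insert x T` in `T` itself, so it lies in the original
  -- intersection; all others are multiples of `x`.
  by_cases hx : m x = 0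
  · refine Ideal.mem_sup_left (mem_varIdeal.2 fun m' hm' T hT => ?_)
    rw [Finset.mem_singleton.1 (support_monomial_subset hm')]
    obtain ⟨i, hi, h⟩ := mem_varIdeal.1 hf m hm _ (Finset.mem_image_of_mem _ hT)
    rcases Finset.mem_insert.1 hi with rfl | hi
    · exact absurd hx h
    · exact ⟨i, hi, h⟩
  · refine Ideal.mem_sup_right (Ideal.mem_span_singleton.2 ?_)
    exact X_dvd_monomial.2 (Or.inr hx)

/-- The exact sequence `0 → (R / (I : x))(-1) → R / I → R / (I, x) → 0` for an intersection `I`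
of primes generated by variables. -/
noncomputable def sesVarIdeal (K : Type u) [Field K] (s : Finset (Finset (Fin n))) (x : Fin n) :
    SES ((quot (varIdeal K (s.filter (x ∉ ·)))).shift 1) (quot (varIdeal K s))
      (quot (varIdeal K (s.image (insert x)))) :=
  sesQuot (fun _ => polyProj_mem_varIdeal) X_mul_mem_varIdeal (varIdeal_le_image_insert s x)
    (X_mem_varIdeal_image_insert s x) (exists_add_of_mem_varIdeal_image_insert s x)

/-- The polynomial ring modulo a set of variables has a linear resolution. -/
theorem regularTo_varIdeal_singleton (N : ℕ) (T : Finset (Fin n)) :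
    RegularTo N 0 (quot (varIdeal K {T})) := by
  induction T using Finset.induction_on with
  | empty =>
    have hbot : varIdeal K {(∅ : Finset (Fin n))} = ⊥ := by simp [varIdeal]
    have := (regularTo_free (K := K) (n := n) (deg := fun _ : Unit => 0) (m := 0)
      (fun _ => le_rfl) N).of_equiv 0 (B := quot (varIdeal K {∅}))
      ((LinearEquiv.funUnique Unit _ _).trans (Submodule.quotEquivOfEqBot _ hbot).symm)
      fun d a => by
        rw [mem_quot_comp]
        constructor
        · rintro ⟨q, hq, h⟩ u
          have h' : q - a () ∈ varIdeal K {∅} := Ideal.Quotient.eq.1 h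
          rw [hbot, Ideal.mem_bot, sub_eq_zero] at h'
          subst h'
          simpa using hq
        · intro h
          exact ⟨a (), by simpa using h (), rfl⟩
    simpa using this
  | insert x T hx ih =>
    -- As `x ∉ T`, multiplication by `x` is injective on the quotient by `T`, and the next quotient
    -- is the cokernel. The twist raises the bound to `1`, which a cokernel tolerates.
    have h1 : ({T} : Finset (Finset (Fin n))).filter (x ∉ ·) = {T} := by
      simp [Finset.filter_singleton, hx]
    have h := (sesVarIdeal K {T} x).regularTo_right (sesQuot_exact _ _ _ _ _) (N := N) (m := 0)
      (by rw [h1]; exact ih.shift 1) ih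
    rwa [Finset.image_singleton] at h

/-- An intersection of `r` primes generated by variables has `reg (R / I) ≤ r - 1`. -/
theorem regularTo_varIdeal (N : ℕ) (s : Finset (Finset (Fin n))) :
    RegularTo N ((s.card : ℤ) - 1) (quot (varIdeal K s)) := by
  -- The induction runs over a set `U` of variables outside which all members of `s` agree.
  suffices ∀ U : Finset (Fin n), ∀ s : Finset (Finset (Fin n)),
      (∀ T ∈ s, ∀ T' ∈ s, ∀ i ∉ U, i ∈ T → i ∈ T') →
      RegularTo N ((s.card : ℤ) - 1) (quot (varIdeal K s)) from
    this Finset.univ s fun _ _ _ _ i hi => absurd (Finset.mem_univ i) hi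
  intro U
  induction U using Finset.induction_on with
  | empty =>
    intro s hs
    rcases s.eq_empty_or_nonempty with rfl | ⟨T, hT⟩
    · have : Subsingleton (quot (varIdeal K (∅ : Finset (Finset (Fin n))))) :=
        Ideal.Quotient.subsingleton_iff.2 (by simp [varIdeal])
      exact regularTo_of_subsingleton _ _ _
    · have : s = {T} := Finset.eq_singleton_iff_unique_mem.2 ⟨hT, fun T' hT' =>
        Finset.ext fun i => ⟨hs T' hT' T hT i (Finset.notMem_empty i),
          hs T hT T' hT' i (Finset.notMem_empty i)⟩⟩
      subst this
      simpa using regularTo_varIdeal_singleton N T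
  | insert x U _ ih =>
    intro s hs
    by_cases h : ∃ T ∈ s, x ∈ T
    · obtain ⟨T, hT, hxT⟩ := h
      -- Both outer families agree at `x` as well: after filtering no member contains it, after
      -- insertion every member does.
      refine (sesVarIdeal K s x).regularTo_middle
        (((ih _ ?_).shift 1).mono ?_) ((ih _ ?_).mono ?_)
      · intro T₁ h₁ T₂ h₂ i hi hi₁
        rw [Finset.mem_filter] at h₁ h₂
        refine hs T₁ h₁.1 T₂ h₂.1 i (fun h => ?_) hi₁
        rcases Finset.mem_insert.1 h with rfl | h
        exacts [h₁.2 hi₁, hi h]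
      · have : (s.filter (x ∉ ·)).card < s.card :=
          Finset.card_lt_card (Finset.filter_ssubset.2 ⟨T, hT, by simpa using hxT⟩)
        omega
      · simp only [Finset.mem_image, forall_exists_index, and_imp, forall_apply_eq_imp_iff₂]
        intro T₁ h₁ T₂ h₂ i hi hi₁
        by_cases hix : i = x
        · exact hix ▸ Finset.mem_insert_self _ _
        · exact Finset.mem_insert_of_mem (hs T₁ h₁ T₂ h₂ i (by simp [hix, hi])
            (Finset.mem_of_mem_insert_of_ne hi₁ hix))
      · have := Finset.card_image_le (s := s) (f := insert x)
        omega
    · push Not at h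
      refine ih s fun T₁ h₁ T₂ h₂ i hi hi₁ => hs T₁ h₁ T₂ h₂ i (fun hU => ?_) hi₁
      rcases Finset.mem_insert.1 hU with rfl | hU
      exacts [h T₁ h₁ hi₁, hi hU]

/-- A monomial ideal that is an intersection of primes is the intersection of the primes
generated by the variables in them. -/
theorem eq_varIdeal {I : Ideal (MvPolynomial (Fin n) K)} (hI : IsMonomialIdeal I) {r : ℕ}
    {p : Fin r → Ideal (MvPolynomial (Fin n) K)} (hp : ∀ j, (p j).IsPrime) (h : I = ⨅ j, p j) :
    ∃ s : Finset (Finset (Fin n)), s.card ≤ r ∧ I = varIdeal K s := by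
  classical
  -- Each prime is replaced by the set of variables it contains; different primes may yield the same
  -- set, hence only an inequality of cardinalities.
  refine ⟨Finset.univ.image fun j => Finset.univ.filter fun i => X i ∈ p j,
    Finset.card_image_le.trans (by simp), le_antisymm ?_ ?_⟩
  · obtain ⟨S, hS⟩ := hI
    rw [hS, Ideal.span_le]
    rintro _ ⟨m, hm, rfl⟩
    rw [SetLike.mem_coe, mem_varIdeal]
    intro m' hm' T hT
    rw [Finset.mem_singleton.1 (support_monomial_subset hm')]
    obtain ⟨j, -, rfl⟩ := Finset.mem_image.1 hT
    have hmj : monomial m (1 : K) ∈ p j := by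
      have : monomial m (1 : K) ∈ I := hS ▸ Ideal.subset_span ⟨m, hm, rfl⟩
      rw [h] at this
      exact (Submodule.mem_iInf _).1 this j
    -- A prime containing a monomial contains one of the variables dividing it.
    rw [monomial_eq, C_1, one_mul, Finsupp.prod, (hp j).prod_mem_iff] at hmj
    obtain ⟨i, hi, hij⟩ := hmj
    exact ⟨i, by simpa using (hp j).mem_of_pow_mem _ hij, Finsupp.mem_support_iff.1 hi⟩
  · rw [h]
    refine le_iInf fun j => (iInf₂_le _ (Finset.mem_image_of_mem _ (Finset.mem_univ j))).trans ?_
    rw [Ideal.span_le]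
    rintro _ ⟨i, hi, rfl⟩
    simpa using hi

end GrMod

theorem IsSquarefreeMonomialIdeal.isMonomialIdeal {n : ℕ} {K : Type*} [Field K]
    {I : Ideal (MvPolynomial (Fin n) K)} (hI : IsSquarefreeMonomialIdeal I) : IsMonomialIdeal I :=
  let ⟨S, _, h⟩ := hI
  ⟨S, h⟩

/-- The bound holds for every squarefree monomial ideal, so that the hypothesis `hdec` of
ass-decomposability is not needed. -/
theorem mainTheorem6 {n : ℕ} {K : Type*} [Field K] (I : Ideal (MvPolynomial (Fin n) K))
    (hI : IsSquarefreeMonomialIdeal I) {r : ℕ} (p : Fin r → Ideal (MvPolynomial (Fin n) K))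
    (hp : IsMinimalPrimeDecomposition I p) (hdec : AssDecomposable I) :
    castelnuovoMumfordRegularity n (quotientComponent I) ≤ (((r : ℤ) - 1 : ℤ) : ℝ) := by
  obtain ⟨s, hs, rfl⟩ := GrMod.eq_varIdeal hI.isMonomialIdeal hp.isPrime hp.iInf_eq
  exact GrMod.regularity_le (fun _ => GrMod.polyProj_mem_varIdeal)
    fun N => (GrMod.regularTo_varIdeal N s).mono (by omega)
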